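/- For an odd prime $p$ let $$T(p)=\sqrt{p}\sum_{n=1}^{(p-1)/2}\tan\frac{\pi n^2}{p}.$$ Let $p$ be a prime. If $p\equiv 3\pmod 8$, then $T(p)>0$, and in the set $\{1,2,\dots,p-1\}$ the number of odd quadratic residues modulo $p$ is strictly greater than the number of even quadratic residues modulo $p$. If $p\equiv 7\pmod 8$, then $T(p)<0$, and in the set $\{1,2,\dots,p-1\}$ the number of even quadratic residues modulo $p$ is strictly greater than the number of odd quadratic residues modulo $p$. -/

import Mathlib

/-- `T(p) = √p · ∑_{n=1}^{(p-1)/2} tan (π n² / p)`. -/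
noncomputable def tanSum (p : ℕ) : ℝ :=
  Real.sqrt p * ∑ n ∈ Finset.Icc 1 ((p - 1) / 2), Real.tan (Real.pi * (n : ℝ) ^ 2 / p)

/-- `k` is a quadratic residue modulo `p`: its class is nonzero and a square. -/
def IsQuadraticResidue (p k : ℕ) : Prop :=
  (k : ZMod p) ≠ 0 ∧ IsSquare (k : ZMod p)

/-- The set of odd quadratic residues modulo `p` in `{1, …, p - 1}`. -/
def oddResidues (p : ℕ) : Set ℕ :=
  {k | k ∈ Set.Icc 1 (p - 1) ∧ Odd k ∧ IsQuadraticResidue p k}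

/-- The set of even quadratic residues modulo `p` in `{1, …, p - 1}`. -/
def evenResidues (p : ℕ) : Set ℕ :=
  {k | k ∈ Set.Icc 1 (p - 1) ∧ Even k ∧ IsQuadraticResidue p k}

/-! Write χ for the Legendre symbol, D = ∑ (-1)^j χ(j) and A = ∑ j χ(j), both over 0 ≤ j < p, with p
≡ 3 mod 4. Both quantities in the theorem are multiples of D.

Counting gives 2(#odd - #even) = -D (`two_mul_ncard_oddResidues_sub`). For the tangents, 1 - i
tan(πk/p) = ∑ (-1)^j e(jk/p), where e(x) = exp(2πix). Summing against χ brings in the Gauss sum,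
whose value i√p yields 2T(p) = -pD (`two_mul_tanSum`). Here the sign of the Gauss sum matters, not
just its square.

Splitting A in two ways gives pD = -2χ(2)(2 - χ(2))A (`alternating_sum_quadraticChar_mul`), so the
sign of D is decided by χ(2), hence by p mod 8, once A < 0 is known. That inequality is analytic: √p
L(1,χ) = -(π/p)A, by Abel summation and the Gauss sum again, and L(1,χ) > 0, by comparison with a
Lambert series (`pos_of_tendsto_sum_div`). -/

/-! ### Polynomial identities modulo p -/

open Finset Polynomial in
-- With q = |K|, the power sums of exponent below q - 1 vanish, so only the leading term
-- contributes, and ∑ x^(q-1) = q - 1 = -1.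
theorem FiniteField.sum_eval_of_monic {K : Type*} [Field K] [Fintype K] {Q : K[X]}
    (hQ : Q.Monic) (hd : Q.natDegree = Fintype.card K - 1) : ∑ x : K, Q.eval x = -1 := by
  simp_rw [Polynomial.eval_eq_sum_range, hd]
  rw [sum_comm, sum_range_succ, sum_eq_zero]
  · have h1 : Q.coeff (Fintype.card K - 1) = 1 := by rw [← hd]; exact hQ
    have h2 : ∑ x : K, x ^ (Fintype.card K - 1) = -1 := by
      classical
      have hc := Fintype.one_lt_card (α := K)
      have : ∀ x : K, x ^ (Fintype.card K - 1) = 1 - if x = 0 then 1 else 0 := by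
        intro x
        by_cases hx : x = 0
        · subst hx; rw [zero_pow (by omega)]; simp
        · rw [FiniteField.pow_card_sub_one_eq_one x hx]; simp [hx]
      simp_rw [this]
      simp
    simp [h1, h2]
  · intro i hi
    rw [← mul_sum, FiniteField.sum_pow_lt_card_sub_one K i (by simpa using hi), mul_zero]

theorem ZMod.sum_eq_sum_range {M : Type*} [AddCommMonoid M] (p : ℕ) [NeZero p] (f : ZMod p → M) :
    ∑ a, f a = ∑ j ∈ Finset.range p, f (j : ZMod p) := by
  refine Finset.sum_nbij' (fun a ↦ a.val) (fun j ↦ (j : ZMod p)) ?_ ?_ ?_ ?_ ?_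
  · intro a _; simpa using ZMod.val_lt a
  · simp
  · intro a _; simp
  · intro j hj; exact ZMod.val_cast_of_lt (by simpa using hj)
  · intro a _; simp

open Finset Polynomial in
-- The summand times m! is the value at j of X^m · X(X-1)⋯(X-m+1), monic of degree 2m = p - 1.
theorem sum_pow_mul_choose {p m : ℕ} [Fact p.Prime] (hp : p = 2 * m + 1) :
    (∑ j ∈ range p, (j : ZMod p) ^ m * (j.choose m : ZMod p)) * (m.factorial : ZMod p) = -1 := by
  have hmon : (X ^ m * descPochhammer (ZMod p) m).Monic :=
    (monic_X_pow m).mul (monic_descPochhammer _ m)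
  have hdeg : (X ^ m * descPochhammer (ZMod p) m).natDegree = Fintype.card (ZMod p) - 1 := by
    rw [(monic_X_pow m).natDegree_mul (monic_descPochhammer _ m), natDegree_X_pow,
      descPochhammer_natDegree, ZMod.card]
    omega
  rw [← FiniteField.sum_eval_of_monic hmon hdeg, ZMod.sum_eq_sum_range, sum_mul]
  refine sum_congr rfl fun j _ ↦ ?_
  rw [eval_mul, eval_pow, eval_X, descPochhammer_eval_eq_descFactorial,
    Nat.descFactorial_eq_factorial_mul_choose]
  push_cast
  ring

open Polynomial in
-- The cyclotomic polynomial Φ_p divides f, and Φ_p ≡ (X-1)^(p-1) mod p. This turns a relation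
-- between complex numbers into congruences.
theorem coeff_comp_X_add_one_of_aeval_eq_zero {p : ℕ} [Fact p.Prime] {η : ℂ}
    (hη : IsPrimitiveRoot η p) {f : ℤ[X]} (hf : aeval η f = 0) {k : ℕ} (hk : k < p - 1) :
    ((f.map (Int.castRingHom (ZMod p))).comp (X + 1)).coeff k = 0 := by
  have hp : p.Prime := Fact.out
  have h1 : cyclotomic p ℤ ∣ f := by
    rw [cyclotomic_eq_minpoly hη hp.pos]
    exact minpoly.isIntegrallyClosed_dvd (hη.isIntegral hp.pos) hf
  have h2 : cyclotomic p (ZMod p) = (X - 1) ^ (p - 1) := by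
    have := cyclotomic_mul_prime_eq_pow_of_not_dvd (ZMod p) (p := p) (n := 1)
      (by simpa using hp.one_lt.ne')
    simpa using this
  obtain ⟨g, rfl⟩ := h1
  rw [Polynomial.map_mul, map_cyclotomic, h2, mul_comp, pow_comp, sub_comp, X_comp, one_comp,
    add_sub_cancel_right, coeff_X_pow_mul', if_neg (by omega)]

open Polynomial in
-- After X ↦ X + 1 each factor has constant term 0 and linear coefficient k - (p - k) = 2k, with k
-- running from 1 to m. The lowest coefficient of the product is therefore ∏ 2k.
theorem coeff_prod_X_pow_sub_X_pow {R : Type*} [CommRing R] (p m : ℕ) (hp : m < p)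
    (h0 : (p : R) = 0) :
    ((∏ k ∈ Finset.range m, (X ^ (k + 1) - X ^ (p - (k + 1)) : R[X])).comp (X + 1)).coeff m =
      2 ^ m * (m.factorial : R) := by
  have key : ∀ k ∈ Finset.range m, ∃ q : R[X],
      (X ^ (k + 1) - X ^ (p - (k + 1)) : R[X]).comp (X + 1) = X * q ∧
        q.coeff 0 = 2 * ((k : R) + 1) := by
    intro k hk
    have hk : k < m := by simpa using hk
    have hd : (X : R[X]) ∣ (X ^ (k + 1) - X ^ (p - (k + 1)) : R[X]).comp (X + 1) := by
      rw [X_dvd_iff]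
      simp [coeff_X_add_one_pow]
    obtain ⟨q, hq⟩ := hd
    refine ⟨q, hq, ?_⟩
    have : ((X ^ (k + 1) - X ^ (p - (k + 1)) : R[X]).comp (X + 1)).coeff 1 = q.coeff 0 := by
      rw [hq, coeff_X_mul]
    rw [← this]
    simp only [sub_comp, pow_comp, X_comp, coeff_sub, coeff_X_add_one_pow, Nat.choose_one_right]
    rw [Nat.cast_sub (by omega), h0]
    push_cast
    ring
  choose! q hq hq0 using key
  rw [prod_comp, Finset.prod_congr rfl hq, Finset.prod_mul_distrib, Finset.prod_const,
    Finset.card_range]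
  have := coeff_X_pow_mul (∏ k ∈ Finset.range m, q k) m 0
  rw [zero_add] at this
  rw [this, coeff_zero_prod, Finset.prod_congr rfl hq0, Finset.prod_mul_distrib,
    Finset.prod_const, Finset.card_range, ← Finset.prod_range_add_one_eq_factorial]
  push_cast
  rfl

/-! ### The quadratic Gauss sum and its sign -/

/-- The quadratic character modulo `p` with complex values. -/
noncomputable def complexQuadraticChar (p : ℕ) [Fact p.Prime] : MulChar (ZMod p) ℂ :=
  (quadraticChar (ZMod p)).ringHomComp (Int.castRingHom ℂ)

theorem complexQuadraticChar_apply {p : ℕ} [Fact p.Prime] (a : ZMod p) :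
    complexQuadraticChar p a = (quadraticChar (ZMod p) a : ℂ) := rfl

theorem ringChar_zmod_ne_two {p : ℕ} [Fact p.Prime] (hp : p ≠ 2) : ringChar (ZMod p) ≠ 2 := by
  rwa [ZMod.ringChar_zmod_n]

theorem gaussSum_complexQuadraticChar_sq {p : ℕ} [Fact p.Prime] (hp : p % 4 = 3) {ψ : AddChar (ZMod p) ℂ}
    (hψ : ψ.IsPrimitive) : gaussSum (complexQuadraticChar p) ψ ^ 2 = -p := by
  have hp2 : ringChar (ZMod p) ≠ 2 := ringChar_zmod_ne_two (by omega)
  have hne : complexQuadraticChar p ≠ 1 := by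
    rw [complexQuadraticChar, ne_eq, MulChar.ringHomComp_eq_one_iff (RingHom.injective_int _)]
    exact quadraticChar_ne_one hp2
  rw [gaussSum_sq hne ((quadraticChar_isQuadratic (ZMod p)).comp _) hψ, ZMod.card,
    complexQuadraticChar_apply, quadraticChar_neg_one hp2, ZMod.card,
    ZMod.χ₄_nat_three_mod_four hp]
  simp

theorem sum_quadraticChar_mul_mulShift {p : ℕ} [Fact p.Prime] (hp : p ≠ 2) (ψ : AddChar (ZMod p) ℂ)
    (b : ZMod p) : ∑ a, (quadraticChar (ZMod p) a : ℂ) * ψ (b * a) =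
      quadraticChar (ZMod p) b * gaussSum (complexQuadraticChar p) ψ := by
  by_cases hb : b = 0
  · subst hb
    have := quadraticChar_sum_zero (ringChar_zmod_ne_two hp)
    simp only [zero_mul, AddChar.map_zero_eq_one, mul_one, MulChar.map_zero, Int.cast_zero]
    exact_mod_cast this
  · have h := gaussSum_mulShift (complexQuadraticChar p) ψ (Units.mk0 b hb)
    have h1 : (quadraticChar (ZMod p) b : ℂ) * quadraticChar (ZMod p) b = 1 := by
      have := quadraticChar_sq_one hb
      rw [sq] at this
      exact_mod_cast this
    rw [← h]
    simp only [Units.val_mk0, complexQuadraticChar_apply]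
    rw [← mul_assoc, h1, one_mul]
    rfl

open Finset in
-- Since (η^k - η^(-k))² = -(1 - η^(2k))(1 - η^(-2k)), the square is (-1)^m times ∏ (1 - ω^k) over 0
-- < k < p with ω = η², and that product is p.
theorem prod_sub_sq_of_isPrimitiveRoot {p m : ℕ} (hp : p = 2 * m + 1) {η : ℂ}
    (hη : IsPrimitiveRoot η p) :
    (∏ k ∈ range m, (η ^ (k + 1) - η ^ (p - (k + 1)))) ^ 2 = (-1) ^ m * p := by
  have hω : IsPrimitiveRoot (η ^ 2) (2 * m + 1) := by
    rw [← hp]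
    exact hη.pow_of_coprime 2 (by rw [hp]; simp)
  have h := hω.prod_one_sub_pow_eq_order
  have hsplit : ∏ k ∈ range (2 * m), (1 - (η ^ 2) ^ (k + 1)) =
      ∏ k ∈ range m, ((1 - (η ^ 2) ^ (k + 1)) * (1 - (η ^ 2) ^ (p - (k + 1)))) := by
    rw [two_mul, prod_range_add, prod_mul_distrib]
    congr 1
    rw [← prod_range_reflect]
    refine prod_congr rfl fun k hk ↦ ?_
    have : k < m := by simpa using hk
    congr 2
    omega
  rw [← prod_pow]
  have hterm : ∀ k ∈ range m, (η ^ (k + 1) - η ^ (p - (k + 1))) ^ 2 =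
      -1 * ((1 - (η ^ 2) ^ (k + 1)) * (1 - (η ^ 2) ^ (p - (k + 1)))) := by
    intro k hk
    have hk : k < m := by simpa using hk
    have h1 : η ^ (k + 1) * η ^ (p - (k + 1)) = 1 := by
      rw [← pow_add, Nat.add_sub_cancel' (by omega), hη.pow_eq_one]
    rw [pow_right_comm η 2 (k + 1), pow_right_comm η 2 (p - (k + 1))]
    linear_combination (η ^ (k + 1) * η ^ (p - (k + 1)) - 1) * h1
  rw [prod_congr rfl hterm, prod_mul_distrib, ← hsplit, h, hp]
  simp

open Finset in
theorem prod_I_mul_neg_one_pow (t : ℕ) :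
    ∏ k ∈ range (2 * t + 1), (Complex.I * (-1) ^ (k + 1)) = -Complex.I := by
  induction t with
  | zero => simp
  | succ t ih =>
    rw [show 2 * (t + 1) + 1 = 2 * t + 1 + 1 + 1 by ring, prod_range_succ, prod_range_succ, ih]
    have h : (-1 : ℂ) ^ (2 * t) = 1 := by rw [pow_mul]; simp
    simp only [pow_succ, h]
    linear_combination Complex.I * Complex.I_mul_I

open Finset in
-- As m + 1 is the inverse of 2 mod p, the root of unity is -exp(πi/p). This choice puts the sine
-- arguments πj/p in (0, π) for 0 < j < p, so the sign of the product of these differences can be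
-- read off.
theorem stdAddChar_half_pow_sub {p m : ℕ} [Fact p.Prime] (hp : p = 2 * m + 1) {j : ℕ}
    (hj : j ≤ p) : (ZMod.stdAddChar ((m + 1 : ℕ) : ZMod p)) ^ j -
      (ZMod.stdAddChar ((m + 1 : ℕ) : ZMod p)) ^ (p - j) =
      (Complex.I * (-1) ^ j) * ((2 * Real.sin (Real.pi * j / p) : ℝ) : ℂ) := by
  have hp0 : (p : ℂ) ≠ 0 := Nat.cast_ne_zero.mpr (Fact.out : p.Prime).ne_zero
  have hη : ZMod.stdAddChar ((m + 1 : ℕ) : ZMod p) =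
      -Complex.exp (Real.pi * Complex.I / p) := by
    have h := ZMod.stdAddChar_coe (N := p) ((m + 1 : ℕ) : ℤ)
    rw [Int.cast_natCast, Int.cast_natCast] at h
    have h2 : 2 * Real.pi * Complex.I * ((m + 1 : ℕ) : ℂ) / p =
        Real.pi * Complex.I + Real.pi * Complex.I / p := by
      field_simp
      rw [hp]; push_cast; ring
    rw [h, h2, Complex.exp_add, Complex.exp_pi_mul_I, neg_one_mul]
  have hpow : ∀ i : ℕ, (ZMod.stdAddChar ((m + 1 : ℕ) : ZMod p)) ^ i =
      (-1) ^ i * Complex.exp ((Real.pi * i / p : ℝ) * Complex.I) := by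
    intro i
    rw [hη, neg_pow, ← Complex.exp_nat_mul]
    congr 2
    push_cast
    ring
  have hinv : (ZMod.stdAddChar ((m + 1 : ℕ) : ZMod p)) ^ (p - j) =
      (-1) ^ j * Complex.exp (-((Real.pi * j / p : ℝ) * Complex.I)) := by
    have h1 : (ZMod.stdAddChar ((m + 1 : ℕ) : ZMod p)) ^ (p - j) *
        (ZMod.stdAddChar ((m + 1 : ℕ) : ZMod p)) ^ j = 1 := by
      rw [← pow_add, Nat.sub_add_cancel hj, ← AddChar.map_nsmul_eq_pow]
      simp
    have h2 : ((-1 : ℂ) ^ j * Complex.exp (-((Real.pi * j / p : ℝ) * Complex.I))) *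
        (ZMod.stdAddChar ((m + 1 : ℕ) : ZMod p)) ^ j = 1 := by
      rw [hpow, mul_mul_mul_comm, ← Complex.exp_add, neg_add_cancel, Complex.exp_zero, mul_one,
        ← mul_pow]
      simp
    have h3 : (ZMod.stdAddChar ((m + 1 : ℕ) : ZMod p)) ^ j ≠ 0 := fun h ↦ by
      rw [h, mul_zero] at h2
      exact zero_ne_one h2
    exact mul_right_cancel₀ h3 (h1.trans h2.symm)
  rw [hpow, hinv, Complex.ofReal_mul, Complex.ofReal_sin, Complex.ofReal_ofNat, Complex.two_sin,
    ← neg_mul]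
  linear_combination (-(-1) ^ j * (Complex.exp (-((Real.pi * j / p : ℝ) : ℂ) * Complex.I) -
    Complex.exp (((Real.pi * j / p : ℝ) : ℂ) * Complex.I))) * Complex.I_mul_I

open Finset in
theorem exists_prod_stdAddChar_half_eq {p m : ℕ} [Fact p.Prime] (hp : p = 2 * m + 1) (hm : m % 2 = 1) :
    ∃ c : ℝ, 0 < c ∧ ∏ k ∈ range m, ((ZMod.stdAddChar ((m + 1 : ℕ) : ZMod p)) ^ (k + 1) -
      (ZMod.stdAddChar ((m + 1 : ℕ) : ZMod p)) ^ (p - (k + 1))) = -Complex.I * c := by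
  refine ⟨∏ k ∈ range m, 2 * Real.sin (Real.pi * (k + 1 : ℕ) / p), prod_pos fun k hk ↦ ?_, ?_⟩
  · have hk : k < m := by simpa using hk
    have hp0 : (0 : ℝ) < p := Nat.cast_pos.mpr (Fact.out : p.Prime).pos
    refine mul_pos two_pos (Real.sin_pos_of_pos_of_lt_pi (by positivity) ?_)
    rw [div_lt_iff₀ hp0]
    have : ((k + 1 : ℕ) : ℝ) < p := by exact_mod_cast (by omega : k + 1 < p)
    gcongr
  · rw [prod_congr rfl fun k hk ↦ stdAddChar_half_pow_sub hp
      (by have : k < m := by simpa using hk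
          omega : k + 1 ≤ p), prod_mul_distrib, Complex.ofReal_prod]
    obtain ⟨t, rfl⟩ : ∃ t, m = 2 * t + 1 := ⟨m / 2, by omega⟩
    rw [prod_I_mul_neg_one_pow]

theorem isPrimitiveRoot_stdAddChar {p : ℕ} [Fact p.Prime] {a : ZMod p} (ha : a ≠ 0) :
    IsPrimitiveRoot (ZMod.stdAddChar a) p := by
  rw [IsPrimitiveRoot.iff_orderOf]
  refine orderOf_eq_prime ?_ ?_
  · rw [← AddChar.map_nsmul_eq_pow]; simp
  · intro h
    rw [← (ZMod.stdAddChar (N := p)).map_zero_eq_one] at h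
    exact ha (ZMod.injective_stdAddChar h)

open Finset Polynomial in
-- Comparing coefficients of X^m modulo p, after X ↦ X + 1, gives ∑ j^m C(j,m) = ε 2^m m!.
-- Multiplying by m! gives ε χ(2) (m!)² = -1. Since -1 is not a square, ε χ(2) = -1.
theorem eq_neg_quadraticChar_two_of_sum_eq {p m : ℕ} [Fact p.Prime] (hp : p = 2 * m + 1)
    (hm : m % 2 = 1) {η : ℂ} (hη : IsPrimitiveRoot η p) {ε : ℤ} (hε : ε = 1 ∨ ε = -1)
    (h : ∑ j ∈ range p, (quadraticChar (ZMod p) (j : ZMod p) : ℂ) * η ^ j =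
      ε * ∏ k ∈ range m, (η ^ (k + 1) - η ^ (p - (k + 1)))) :
    ε = -quadraticChar (ZMod p) 2 := by
  have hp2 : ringChar (ZMod p) ≠ 2 := ringChar_zmod_ne_two (by omega)
  have hcard : Fintype.card (ZMod p) / 2 = m := by rw [ZMod.card]; omega
  have hcoe : ∀ a : ZMod p, ((quadraticChar (ZMod p) a : ℤ) : ZMod p) = a ^ m := fun a ↦ by
    rw [quadraticChar_eq_pow_of_char_ne_two' hp2, hcard]
  have h0 : aeval η (∑ j ∈ range p, C (quadraticChar (ZMod p) (j : ZMod p)) * X ^ j -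
      C ε * ∏ k ∈ range m, (X ^ (k + 1) - X ^ (p - (k + 1))) : ℤ[X]) = 0 := by
    simp only [map_sub, map_sum, map_mul, map_prod, map_pow, aeval_X, aeval_C]
    simpa [sub_eq_zero] using h
  have h1 := coeff_comp_X_add_one_of_aeval_eq_zero hη h0 (k := m) (by omega)
  have h2 := coeff_prod_X_pow_sub_X_pow (R := ZMod p) p m (by omega) (by simp)
  simp only [Polynomial.map_sub, Polynomial.map_sum, Polynomial.map_mul, Polynomial.map_prod,
    Polynomial.map_pow, map_X, map_C, sub_comp, mul_comp, C_comp, coeff_sub, coeff_C_mul,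
    h2, Polynomial.sum_comp, finsetSum_coeff, X_pow_comp, coeff_X_add_one_pow] at h1
  simp only [eq_intCast, hcoe] at h1
  have h3 := sum_pow_mul_choose hp
  rw [sub_eq_zero.mp h1] at h3
  have h4 : ((ε * quadraticChar (ZMod p) 2 : ℤ) : ZMod p) * (m.factorial : ZMod p) ^ 2 = -1 := by
    rw [Int.cast_mul, hcoe, ← h3]; ring
  have h20 : (2 : ZMod p) ≠ 0 := by
    intro h
    have : ((2 : ℕ) : ZMod p) = 0 := by exact_mod_cast h
    rw [ZMod.natCast_eq_zero_iff] at this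
    have := Nat.le_of_dvd two_pos this
    have := (Fact.out : p.Prime).two_le
    omega
  have hns : ¬ IsSquare (-1 : ZMod p) := by
    rw [ZMod.exists_sq_eq_neg_one_iff]; omega
  have h5 : ε * quadraticChar (ZMod p) 2 ≠ 1 := by
    intro h
    rw [h] at h4
    exact hns ⟨m.factorial, by rw [← h4]; push_cast; ring⟩
  rcases hε with rfl | rfl <;> rcases quadraticChar_dichotomy h20 with h | h <;> simp [h] at h5 ⊢

open Finset in
/-- **Gauss's determination of the sign of the quadratic Gauss sum**, for `p ≡ 3 mod 4`. -/
theorem gaussSum_complexQuadraticChar_stdAddChar {p : ℕ} [Fact p.Prime] (hp : p % 4 = 3) :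
    gaussSum (complexQuadraticChar p) ZMod.stdAddChar = Complex.I * (Real.sqrt p : ℝ) := by
  obtain ⟨m, hpm⟩ : ∃ m, p = 2 * m + 1 := ⟨p / 2, by omega⟩
  have hm : m % 2 = 1 := by omega
  set G := gaussSum (complexQuadraticChar p) ZMod.stdAddChar with hG
  have h2h : (2 : ZMod p) * ((m + 1 : ℕ) : ZMod p) = 1 := by
    have : ((2 * m + 1 : ℕ) : ZMod p) = 0 := by rw [← hpm, ZMod.natCast_self]
    push_cast at this ⊢
    linear_combination this
  have hh0 : ((m + 1 : ℕ) : ZMod p) ≠ 0 := right_ne_zero_of_mul_eq_one h2h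
  have hη := isPrimitiveRoot_stdAddChar hh0
  obtain ⟨c, hc, hP⟩ := exists_prod_stdAddChar_half_eq hpm hm
  have hsq := prod_sub_sq_of_isPrimitiveRoot hpm hη
  set η := ZMod.stdAddChar ((m + 1 : ℕ) : ZMod p) with hηdef
  set h : ZMod p := ((m + 1 : ℕ) : ZMod p)
  have hGsq : G ^ 2 = -p := gaussSum_complexQuadraticChar_sq hp (ZMod.isPrimitive_stdAddChar p)
  have hχh : quadraticChar (ZMod p) 2 * quadraticChar (ZMod p) h = 1 := by
    rw [← map_mul, h2h, map_one]
  have hS : ∑ j ∈ range p, (quadraticChar (ZMod p) (j : ZMod p) : ℂ) * η ^ j =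
      quadraticChar (ZMod p) h * G := by
    rw [hG, ← sum_quadraticChar_mul_mulShift (by omega), ZMod.sum_eq_sum_range]
    refine sum_congr rfl fun j _ ↦ ?_
    rw [hηdef, ← AddChar.map_nsmul_eq_pow, nsmul_eq_mul, mul_comm h]
  rw [hP, Odd.neg_one_pow (Nat.odd_iff.mpr hm)] at hsq
  -- Both χ(h)G and the product -ic have square -p, so they agree up to a sign ε, which the
  -- congruence then determines.
  have hor : quadraticChar (ZMod p) h * G = ((1 : ℤ) : ℂ) * (-Complex.I * c) ∨
      quadraticChar (ZMod p) h * G = ((-1 : ℤ) : ℂ) * (-Complex.I * c) := by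
    have h1 : (quadraticChar (ZMod p) h : ℂ) ^ 2 = 1 := by
      exact_mod_cast quadraticChar_sq_one hh0
    have := sq_eq_sq_iff_eq_or_eq_neg.mp
      (show (quadraticChar (ZMod p) h * G) ^ 2 = (-Complex.I * c) ^ 2 by
        rw [mul_pow, h1, hGsq, hsq]; ring)
    simpa using this
  obtain ⟨ε, hε, hεG⟩ : ∃ ε : ℤ, (ε = 1 ∨ ε = -1) ∧
      quadraticChar (ZMod p) h * G = (ε : ℂ) * (-Complex.I * c) := by
    rcases hor with h | h
    exacts [⟨1, Or.inl rfl, h⟩, ⟨-1, Or.inr rfl, h⟩]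
  have hε2 := eq_neg_quadraticChar_two_of_sum_eq hpm hm hη hε (by rw [hS, hεG, hP])
  have hGc : G = Complex.I * c := by
    have h1 : (quadraticChar (ZMod p) 2 : ℂ) * quadraticChar (ZMod p) h = 1 := by
      exact_mod_cast hχh
    have h2 : (quadraticChar (ZMod p) 2 : ℂ) ^ 2 = 1 := by
      exact_mod_cast quadraticChar_sq_one (left_ne_zero_of_mul_eq_one h2h)
    rw [hε2] at hεG
    push_cast at hεG
    linear_combination (-G) * h1 + (quadraticChar (ZMod p) 2 : ℂ) * hεG + Complex.I * c * h2
  have hcp : c ^ 2 = p := by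
    have h1 : (c : ℂ) ^ 2 = p := by
      linear_combination -hsq - (c : ℂ) ^ 2 * (-1) * Complex.I_sq
    exact_mod_cast h1
  rw [hGc, ← hcp, Real.sqrt_sq hc.le]

/-! ### Evaluation of L(1,χ) as a finite sum -/

theorem Complex.one_sub_exp_mul_I (θ : ℝ) : 1 - Complex.exp (θ * Complex.I) =
    (2 * Real.sin (θ / 2) : ℝ) * (Complex.cos ((θ - Real.pi) / 2 : ℝ) +
      Complex.sin ((θ - Real.pi) / 2 : ℝ) * Complex.I) := by
  have h1 : ((θ - Real.pi) / 2 : ℝ) = θ / 2 - Real.pi / 2 := by ring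
  rw [h1, ← Complex.ofReal_cos, ← Complex.ofReal_sin, Real.cos_sub_pi_div_two,
    Real.sin_sub_pi_div_two, Complex.exp_mul_I, ← Complex.ofReal_cos, ← Complex.ofReal_sin]
  have h2 : θ = 2 * (θ / 2) := by ring
  apply Complex.ext
  · simp only [Complex.sub_re, Complex.add_re, Complex.mul_re, Complex.ofReal_re,
      Complex.ofReal_im, Complex.I_re, Complex.I_im, Complex.one_re, Complex.add_im,
      Complex.mul_im]
    nth_rw 1 [h2]
    rw [Real.cos_two_mul]
    linear_combination (-2) * Real.sin_sq_add_cos_sq (θ / 2)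
  · simp only [Complex.sub_im, Complex.add_re, Complex.mul_re, Complex.ofReal_re,
      Complex.ofReal_im, Complex.I_re, Complex.I_im, Complex.one_im, Complex.add_im,
      Complex.mul_im]
    nth_rw 1 [h2]
    rw [Real.sin_two_mul]
    ring

theorem Complex.arg_one_sub_exp_mul_I {θ : ℝ} (h0 : 0 < θ) (h1 : θ < 2 * Real.pi) :
    Complex.arg (1 - Complex.exp (θ * Complex.I)) = (θ - Real.pi) / 2 := by
  rw [Complex.one_sub_exp_mul_I, Complex.arg_mul_cos_add_sin_mul_I]
  · exact mul_pos two_pos (Real.sin_pos_of_pos_of_lt_pi (by linarith) (by linarith))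
  · constructor <;> linarith [Real.pi_pos]

open Filter Topology in
theorem Complex.tendsto_arg_one_sub_mul_exp {θ : ℝ} (h0 : 0 < θ) (h1 : θ < 2 * Real.pi) :
    Tendsto (fun r : ℝ ↦ Complex.arg (1 - r * Complex.exp (θ * Complex.I))) (𝓝[<] 1)
      (𝓝 ((θ - Real.pi) / 2)) := by
  have hs : 1 - Complex.exp (θ * Complex.I) ∈ Complex.slitPlane := by
    rw [Complex.mem_slitPlane_iff_arg, Complex.arg_one_sub_exp_mul_I h0 h1,
      Complex.one_sub_exp_mul_I]
    refine ⟨by linarith, mul_ne_zero ?_ ?_⟩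
    · exact_mod_cast
        (mul_pos two_pos (Real.sin_pos_of_pos_of_lt_pi (by linarith) (by linarith))).ne'
    · rw [← Complex.exp_mul_I]
      exact Complex.exp_ne_zero _
  have hc : ContinuousAt (fun r : ℝ ↦ Complex.arg (1 - r * Complex.exp (θ * Complex.I))) 1 := by
    refine (Complex.continuousAt_arg hs).comp_of_eq
      (f := fun r : ℝ ↦ 1 - r * Complex.exp (θ * Complex.I)) ?_ ?_
    · fun_prop
    · simp
  have h := hc.tendsto
  simp only [Complex.ofReal_one, one_mul, Complex.arg_one_sub_exp_mul_I h0 h1] at h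
  exact h.mono_left nhdsWithin_le_nhds

theorem stdAddChar_natCast_mul {p : ℕ} [NeZero p] (n j : ℕ) :
    ZMod.stdAddChar ((n : ZMod p) * (j : ZMod p)) =
      Complex.exp ((2 * Real.pi * j / p : ℝ) * Complex.I) ^ n := by
  have h := ZMod.stdAddChar_coe (N := p) ((n * j : ℕ) : ℤ)
  rw [Int.cast_natCast, Int.cast_natCast, Nat.cast_mul, Nat.cast_mul] at h
  rw [h, ← Complex.exp_nat_mul]
  congr 1
  push_cast
  ring

open Finset in
-- Expand i√p χ(n) = ∑ χ(j) e(jn/p), sum over n into -log(1 - r e(j/p)), and take imaginary parts.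
theorem sqrt_mul_tsum_quadraticChar {p : ℕ} [Fact p.Prime] (hp : p % 4 = 3) {r : ℝ} (hr0 : 0 < r)
    (hr1 : r < 1) :
    Real.sqrt p * ∑' n : ℕ, (quadraticChar (ZMod p) (n : ZMod p) : ℝ) / n * r ^ n =
      ∑ j ∈ range p, (quadraticChar (ZMod p) (j : ZMod p) : ℝ) *
        -Complex.arg (1 - r * Complex.exp ((2 * Real.pi * j / p : ℝ) * Complex.I)) := by
  have h1 : ∀ j ∈ range p, HasSum (fun n : ℕ ↦ (quadraticChar (ZMod p) (j : ZMod p) : ℂ) *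
      ((r * Complex.exp ((2 * Real.pi * j / p : ℝ) * Complex.I)) ^ n / n))
      ((quadraticChar (ZMod p) (j : ZMod p) : ℂ) *
        -Complex.log (1 - r * Complex.exp ((2 * Real.pi * j / p : ℝ) * Complex.I))) := by
    intro j _
    refine (Complex.hasSum_taylorSeries_neg_log ?_).mul_left _
    rw [norm_mul, Complex.norm_exp_ofReal_mul_I, mul_one, Complex.norm_of_nonneg hr0.le]
    exact hr1
  have h2 := Complex.hasSum_im (hasSum_sum h1)
  have h3 : ∀ n : ℕ, (∑ j ∈ range p, (quadraticChar (ZMod p) (j : ZMod p) : ℂ) *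
      ((r * Complex.exp ((2 * Real.pi * j / p : ℝ) * Complex.I)) ^ n / n)).im =
      Real.sqrt p * ((quadraticChar (ZMod p) (n : ZMod p) : ℝ) / n * r ^ n) := by
    intro n
    have h4 := sum_quadraticChar_mul_mulShift (p := p) (by omega) ZMod.stdAddChar (n : ZMod p)
    rw [gaussSum_complexQuadraticChar_stdAddChar hp, ZMod.sum_eq_sum_range] at h4
    simp_rw [stdAddChar_natCast_mul] at h4
    have h5 : ∑ j ∈ range p, (quadraticChar (ZMod p) (j : ZMod p) : ℂ) *
        ((r * Complex.exp ((2 * Real.pi * j / p : ℝ) * Complex.I)) ^ n / n) =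
        ((Real.sqrt p * ((quadraticChar (ZMod p) (n : ZMod p) : ℝ) / n * r ^ n) : ℝ) : ℂ) *
          Complex.I := by
      calc _ = (∑ j ∈ range p, (quadraticChar (ZMod p) (j : ZMod p) : ℂ) *
            Complex.exp ((2 * Real.pi * j / p : ℝ) * Complex.I) ^ n) * (r ^ n / n) := by
            rw [sum_mul]
            refine sum_congr rfl fun j _ ↦ ?_
            rw [mul_pow]
            ring
        _ = _ := by
            rw [h4]
            push_cast
            ring
    rw [h5, Complex.im_ofReal_mul, Complex.I_im, mul_one]
  simp_rw [h3] at h2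
  rw [← tsum_mul_left, h2.tsum_eq, Complex.im_sum]
  refine sum_congr rfl fun j _ ↦ ?_
  rw [← Complex.ofReal_intCast, Complex.im_ofReal_mul, Complex.neg_im, Complex.log_im]

open Finset Filter Topology in
-- Abel's theorem lets r → 1 in the preceding identity. The limiting arguments are πj/p - π/2, and
-- the constant drops out because ∑ χ = 0.
theorem sqrt_mul_eq_neg_pi_div_mul_sum {p : ℕ} [Fact p.Prime] (hp : p % 4 = 3) {L : ℝ}
    (hL : Tendsto (fun n ↦ ∑ i ∈ range n,
      (quadraticChar (ZMod p) ((i + 1 : ℕ) : ZMod p) : ℝ) / ((i : ℝ) + 1)) atTop (𝓝 L)) :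
    Real.sqrt p * L = -(Real.pi / p) *
      ∑ j ∈ range p, (quadraticChar (ZMod p) (j : ZMod p) : ℝ) * j := by
  have hp0 : (0 : ℝ) < p := Nat.cast_pos.mpr (Fact.out : p.Prime).pos
  have hL' : Tendsto (fun n ↦ ∑ i ∈ range n, (quadraticChar (ZMod p) (i : ZMod p) : ℝ) / i) atTop
      (𝓝 L) := by
    rw [← tendsto_add_atTop_iff_nat 1]
    refine hL.congr fun n ↦ ?_
    rw [sum_range_succ']
    simp
  have h1 := (Real.tendsto_tsum_powerSeries_nhdsWithin_lt hL').const_mul (Real.sqrt p)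
  have h2 : Tendsto (fun r : ℝ ↦ ∑ j ∈ range p, (quadraticChar (ZMod p) (j : ZMod p) : ℝ) *
      -Complex.arg (1 - r * Complex.exp ((2 * Real.pi * j / p : ℝ) * Complex.I))) (𝓝[<] 1)
      (𝓝 (∑ j ∈ range p, (quadraticChar (ZMod p) (j : ZMod p) : ℝ) *
        -((2 * Real.pi * j / p - Real.pi) / 2))) := by
    refine tendsto_finsetSum _ fun j hj ↦ ?_
    -- At j = 0 the argument formula is unavailable, but χ(0) = 0.
    rcases Nat.eq_zero_or_pos j with rfl | hj0
    · simp
    · have hjp : (j : ℝ) < p := by exact_mod_cast mem_range.mp hj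
      refine (Complex.tendsto_arg_one_sub_mul_exp (by positivity) ?_).neg.const_mul _
      rw [div_lt_iff₀ hp0]
      have := Real.pi_pos
      gcongr
  have h3 := tendsto_nhds_unique (h2.congr' ?_) h1
  · rw [← h3, mul_sum]
    have h4 : ∑ j ∈ range p, (quadraticChar (ZMod p) (j : ZMod p) : ℝ) * (Real.pi / 2) = 0 := by
      rw [← sum_mul, ← ZMod.sum_eq_sum_range p (fun a ↦ (quadraticChar (ZMod p) a : ℝ))]
      have := quadraticChar_sum_zero (ringChar_zmod_ne_two (p := p) (by omega))
      rw [show ∑ a, (quadraticChar (ZMod p) a : ℝ) = 0 by exact_mod_cast this, zero_mul]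
    rw [← sub_eq_zero, ← sum_sub_distrib, ← h4]
    refine sum_congr rfl fun j _ ↦ ?_
    field_simp
    ring
  · filter_upwards [Ioo_mem_nhdsLT (zero_lt_one (α := ℝ))] with r hr
    exact (sqrt_mul_tsum_quadraticChar hp hr.1 hr.2).symm

/-! ### Positivity of L(1) from Lambert series -/

open Finset in
-- Expanding the geometric series and grouping pairs by their product N turns the Lambert series
-- into ∑ (∑_{d ∣ N} f d) r^N, whose terms are nonnegative.
theorem hasSum_lambert_and_sum_le {f : ℕ → ℝ} (hf : ∀ n, |f n| ≤ 1)
    (hnn : ∀ N : ℕ, 0 ≤ ∑ d ∈ N.divisors, f d) {S : Finset ℕ+}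
    (hS : ∀ N ∈ S, 1 ≤ ∑ d ∈ (N : ℕ).divisors, f d) {r : ℝ} (hr0 : 0 < r) (hr1 : r < 1) :
    ∃ Λ : ℝ, HasSum (fun n : ℕ+ ↦ f n * (r ^ (n : ℕ) / (1 - r ^ (n : ℕ)))) Λ ∧
      ∑ N ∈ S, r ^ (N : ℕ) ≤ Λ := by
  have hnorm : ‖r‖ < 1 := by rwa [Real.norm_of_nonneg hr0.le]
  have hF : Summable fun x : ℕ+ × ℕ+ ↦ f x.1 * r ^ (x.1 * x.2 : ℕ) := by
    refine Summable.of_norm_bounded (summable_prod_mul_pow 0 hnorm) fun x ↦ ?_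
    rw [norm_mul, norm_pow, Real.norm_of_nonneg hr0.le, pow_zero, Real.norm_eq_abs]
    gcongr
    exact hf _
  obtain ⟨Λ, hΛ⟩ := hF
  refine ⟨Λ, hΛ.prod_fiberwise fun n ↦ ?_, ?_⟩
  · refine HasSum.mul_left _ ?_
    have hn : r ^ (n : ℕ) < 1 := pow_lt_one₀ hr0.le hr1 n.ne_zero
    have h := (hasSum_geometric_of_lt_one (by positivity) hn).mul_left (r ^ (n : ℕ))
    rw [← div_eq_mul_inv] at h
    have h2 := (Equiv.pnatEquivNat.hasSum_iff
      (f := fun m : ℕ ↦ r ^ (n : ℕ) * (r ^ (n : ℕ)) ^ m)).mpr h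
    refine h2.congr_fun ?_ |> id
    intro m
    simp only [Function.comp, Equiv.pnatEquivNat_apply]
    rw [← pow_succ', ← pow_mul]
    congr 2
    exact (PNat.natPred_add_one m).symm
  · have h1 := sigmaAntidiagonalEquivProd.hasSum_iff.mpr hΛ
    have h2 := h1.sigma fun N ↦ hasSum_fintype _
    have h3 : ∀ N : ℕ+, (∑ x : Nat.divisorsAntidiagonal N,
        ((fun x : ℕ+ × ℕ+ ↦ f x.1 * r ^ (x.1 * x.2 : ℕ)) ∘ sigmaAntidiagonalEquivProd) ⟨N, x⟩) =
        (∑ d ∈ (N : ℕ).divisors, f d) * r ^ (N : ℕ) := by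
      intro N
      rw [sum_mul, ← Nat.sum_divisorsAntidiagonal (fun d _ ↦ f d * r ^ (N : ℕ)),
        univ_eq_attach, ← sum_attach (Nat.divisorsAntidiagonal N) fun x ↦ f x.1 * r ^ (N : ℕ)]
      refine sum_congr rfl fun x _ ↦ ?_
      simp [sigmaAntidiagonalEquivProd, divisorsAntidiagonalFactors,
        (Nat.mem_divisorsAntidiagonal.mp x.2).1]
    simp_rw [h3] at h2
    refine le_trans (sum_le_sum fun N hN ↦ ?_) (sum_le_hasSum S (fun N _ ↦ ?_) h2)
    · exact le_mul_of_one_le_left (by positivity) (hS N hN)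
    · exact mul_nonneg (hnn N) (by positivity)

open Finset in
-- Summation by parts; the nonnegative differences of b telescope.
theorem abs_sum_mul_le_of_antitone {b c : ℕ → ℝ} (hb : Antitone b) (hb0 : ∀ n, 0 ≤ b n) {C : ℝ}
    (hc : ∀ n, |∑ i ∈ range n, c i| ≤ C) (n : ℕ) :
    |∑ i ∈ range n, b i * c i| ≤ C * b 0 := by
  have h1 : ∀ n, ∑ i ∈ range n, b i * c i = b n * ∑ i ∈ range n, c i +
      ∑ i ∈ range n, (b i - b (i + 1)) * ∑ j ∈ range (i + 1), c j := by
    intro n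
    induction n with
    | zero => simp
    | succ n ih => simp only [sum_range_succ, ih]; ring
  rw [h1]
  calc _ ≤ |b n * ∑ i ∈ range n, c i| +
        ∑ i ∈ range n, |(b i - b (i + 1)) * ∑ j ∈ range (i + 1), c j| :=
        (abs_add_le _ _).trans (by gcongr; exact abs_sum_le_sum_abs _ _)
    _ ≤ b n * C + ∑ i ∈ range n, (b i - b (i + 1)) * C := by
        gcongr with i hi
        · rw [abs_mul, abs_of_nonneg (hb0 n)]
          exact mul_le_mul_of_nonneg_left (hc n) (hb0 n)
        · have := sub_nonneg.mpr (hb (Nat.le_succ i))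
          rw [abs_mul, abs_of_nonneg this]
          exact mul_le_mul_of_nonneg_left (hc _) this
    _ = C * b 0 := by rw [← sum_mul, sum_range_sub']; ring

open Finset in
-- AM-GM on the terms k and n - 1 - k. The base t² avoids half-integral exponents.
theorem mul_pow_le_geom_sum_sq (t : ℝ) (n : ℕ) :
    n * t ^ (n - 1) ≤ ∑ k ∈ range n, (t ^ 2) ^ k := by
  have h : 2 * (n * t ^ (n - 1)) ≤ 2 * ∑ k ∈ range n, (t ^ 2) ^ k := by
    calc 2 * (n * t ^ (n - 1)) = ∑ k ∈ range n, 2 * t ^ (n - 1) := by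
          rw [sum_const, card_range, nsmul_eq_mul]; ring
      _ ≤ ∑ k ∈ range n, ((t ^ 2) ^ k + (t ^ 2) ^ (n - 1 - k)) := by
          refine sum_le_sum fun k hk ↦ ?_
          have hk : k < n := by simpa using hk
          have h1 : t ^ (n - 1) = t ^ k * t ^ (n - 1 - k) := by
            rw [← pow_add]; congr 1; omega
          rw [h1, pow_right_comm t 2 k, pow_right_comm t 2 (n - 1 - k)]
          nlinarith [sq_nonneg (t ^ k - t ^ (n - 1 - k))]
      _ = 2 * ∑ k ∈ range n, (t ^ 2) ^ k := by
          rw [sum_add_distrib, sum_range_reflect (fun k ↦ (t ^ 2) ^ k), two_mul]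
  linarith

open Finset in
-- With r = t² and g_n = 1 + ⋯ + r^(n-1), the relation g_(n+1) = r g_n + 1 makes the n-th decrement
-- 1/(n(n+1)) - r^n/(g_n g_(n+1)). The AM-GM bound applied to g_n and g_(n+1) makes it nonnegative.
theorem antitone_inv_sub_pow_div_geom_sum {t : ℝ} (ht0 : 0 < t) (ht1 : t < 1) :
    Antitone fun n : ℕ ↦ 1 / ((n : ℝ) + 1) -
      (t ^ 2) ^ (n + 1) / ∑ k ∈ range (n + 1), (t ^ 2) ^ k := by
  refine antitone_nat_of_succ_le fun n ↦ ?_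
  set g : ℕ → ℝ := fun n ↦ ∑ k ∈ range n, (t ^ 2) ^ k with hg
  have hpos : ∀ n, 0 < g (n + 1) := fun n ↦ sum_pos (fun _ _ ↦ by positivity) (by simp)
  have h1 := mul_pow_le_geom_sum_sq t (n + 1)
  have h2 := mul_pow_le_geom_sum_sq t (n + 2)
  have e1 : g (n + 2) = t ^ 2 * g (n + 1) + 1 := by
    simp only [hg]; exact geom_sum_succ
  have hprod : ((n : ℝ) + 1) * (n + 2) * (t ^ 2) ^ (n + 1) ≤ g (n + 1) * g (n + 2) := by
    calc ((n : ℝ) + 1) * (n + 2) * (t ^ 2) ^ (n + 1)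
        ≤ ((n : ℝ) + 1) * (n + 2) * t ^ (2 * n + 1) := by
          gcongr
          rw [← pow_mul]
          exact pow_le_pow_of_le_one ht0.le ht1.le (by omega)
      _ = (((n + 1 : ℕ) : ℝ) * t ^ (n + 1 - 1)) * (((n + 2 : ℕ) : ℝ) * t ^ (n + 2 - 1)) := by
          rw [Nat.add_sub_cancel, show n + 2 - 1 = n + 1 by omega]
          push_cast
          ring
      _ ≤ g (n + 1) * g (n + 2) := mul_le_mul h1 h2 (by positivity) (hpos n).le
  have hA : 1 / ((n : ℝ) + 1) - 1 / ((n : ℝ) + 2) = 1 / (((n : ℝ) + 1) * (n + 2)) := by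
    field_simp; ring
  have hB : (t ^ 2) ^ (n + 1) / g (n + 1) - (t ^ 2) ^ (n + 2) / g (n + 2) =
      (t ^ 2) ^ (n + 1) / (g (n + 1) * g (n + 2)) := by
    rw [div_sub_div _ _ (hpos n).ne' (hpos (n + 1)).ne', e1]
    congr 1
    ring
  have hC : (t ^ 2) ^ (n + 1) / (g (n + 1) * g (n + 2)) ≤ 1 / (((n : ℝ) + 1) * (n + 2)) := by
    rw [div_le_div_iff₀ (mul_pos (hpos n) (hpos (n + 1))) (by positivity)]
    linarith
  have hD : ((n + 1 : ℕ) : ℝ) + 1 = n + 2 := by push_cast; ring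
  change 1 / (((n + 1 : ℕ) : ℝ) + 1) - (t ^ 2) ^ (n + 2) / g (n + 2) ≤
    1 / ((n : ℝ) + 1) - (t ^ 2) ^ (n + 1) / g (n + 1)
  rw [hD]
  linarith

open Finset Filter Topology in
/-- A real sequence with bounded partial sums, whose divisor sums are nonnegative and infinitely
often at least `1`, has `∑ f n / n > 0` as soon as this series converges. -/
theorem pos_of_tendsto_sum_div {f : ℕ → ℝ} (hf : ∀ n, |f n| ≤ 1) {C : ℝ}
    (hC : ∀ n, |∑ i ∈ range n, f (i + 1)| ≤ C)
    (hnn : ∀ N : ℕ, 0 ≤ ∑ d ∈ N.divisors, f d)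
    (hinf : {N : ℕ+ | 1 ≤ ∑ d ∈ (N : ℕ).divisors, f d}.Infinite) {L : ℝ}
    (hL : Tendsto (fun n ↦ ∑ i ∈ range n, f (i + 1) / ((i : ℝ) + 1)) atTop (𝓝 L)) : 0 < L := by
  -- K > C indices with divisor sum at least 1 force the Lambert sum Λ above C once r = t² is close
  -- to 1.
  obtain ⟨K, hK⟩ := exists_nat_gt C
  obtain ⟨S, hS, hcard⟩ := hinf.exists_subset_card_eq K
  have htend : Tendsto (fun t : ℝ ↦ ∑ N ∈ S, (t ^ 2) ^ (N : ℕ)) (𝓝[<] 1) (𝓝 K) := by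
    have : Continuous fun t : ℝ ↦ ∑ N ∈ S, (t ^ 2) ^ (N : ℕ) := by fun_prop
    have h := this.tendsto 1
    simp only [one_pow, sum_const, hcard, nsmul_eq_mul, mul_one] at h
    exact h.mono_left nhdsWithin_le_nhds
  obtain ⟨t, htC, ht0, ht1⟩ := ((htend.eventually (lt_mem_nhds hK)).and
    (Ioo_mem_nhdsLT (zero_lt_one (α := ℝ)))).exists
  have hr0 : 0 < t ^ 2 := by positivity
  have hr1 : t ^ 2 < 1 := pow_lt_one₀ ht0.le ht1 two_ne_zero
  obtain ⟨Λ, hΛ, hSΛ⟩ := hasSum_lambert_and_sum_le hf hnn hS hr0 hr1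
  set r := t ^ 2 with hr
  have hΛ' : HasSum (fun n : ℕ ↦ f (n + 1) * (r ^ (n + 1) / (1 - r ^ (n + 1)))) Λ := by
    rw [← Equiv.pnatEquivNat.symm.hasSum_iff] at hΛ
    simpa [Function.comp_def] using hΛ
  -- These weights give L - (1 - r)Λ = ∑ b_n f(n+1). Since b_0 = 1 - r, that sum is at least -C(1 -
  -- r), hence L ≥ (1 - r)(Λ - C) > 0.
  set b : ℕ → ℝ := fun n ↦ 1 / ((n : ℝ) + 1) - r ^ (n + 1) / ∑ k ∈ range (n + 1), r ^ k with hb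
  have hanti : Antitone b := antitone_inv_sub_pow_div_geom_sum ht0 ht1
  have hgeom : ∀ n : ℕ, r ^ (n + 1) / ∑ k ∈ range (n + 1), r ^ k =
      (1 - r) * (r ^ (n + 1) / (1 - r ^ (n + 1))) := by
    intro n
    have h1 : 1 - r ^ (n + 1) ≠ 0 := (sub_pos.mpr (pow_lt_one₀ hr0.le hr1 n.succ_ne_zero)).ne'
    have h2 := geom_sum_mul_neg r (n + 1)
    have h3 : ∑ k ∈ range (n + 1), r ^ k ≠ 0 := left_ne_zero_of_mul (h2 ▸ h1)
    rw [← h2] at h1 ⊢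
    have h4 : 1 - r ≠ 0 := right_ne_zero_of_mul h1
    field_simp
  have hbnn : ∀ n, 0 ≤ b n := by
    intro n
    have h1 : ((n : ℝ) + 1) * r ^ (n + 1) ≤ ∑ k ∈ range (n + 1), r ^ k := by
      calc ((n : ℝ) + 1) * r ^ (n + 1) = ∑ k ∈ range (n + 1), r ^ (n + 1) := by simp
        _ ≤ _ := sum_le_sum fun k hk ↦ pow_le_pow_of_le_one hr0.le hr1.le
            (by have : k < n + 1 := by simpa using hk
                omega)
    have h2 : 0 < ∑ k ∈ range (n + 1), r ^ k := sum_pos (fun _ _ ↦ by positivity) (by simp)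
    rw [hb, sub_nonneg, div_le_div_iff₀ h2 (by positivity)]
    linarith
  have hb0 : b 0 = 1 - r := by simp [hb]
  have hbound := abs_sum_mul_le_of_antitone hanti hbnn hC
  have hlim : Tendsto (fun n ↦ ∑ i ∈ range n, b i * f (i + 1)) atTop (𝓝 (L - (1 - r) * Λ)) := by
    refine (hL.sub (hΛ'.tendsto_sum_nat.const_mul (1 - r))).congr fun n ↦ ?_
    rw [mul_sum, ← sum_sub_distrib]
    refine sum_congr rfl fun i _ ↦ ?_
    simp only [hb, hgeom]
    ring
  have hge : -(C * (1 - r)) ≤ L - (1 - r) * Λ :=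
    ge_of_tendsto' hlim fun n ↦ by
      have := (abs_le.mp (hbound n)).1
      rwa [hb0] at this
  have : 0 < (1 - r) * (Λ - C) := mul_pos (by linarith) (by linarith)
  linarith

/-! ### Positivity of L(1,χ) for the quadratic character -/

open Finset in
theorem abs_sum_range_le_of_periodic {f : ℕ → ℝ} {p : ℕ} (hp : 0 < p)
    (hper : ∀ n, f (n + p) = f n) (hsum : ∑ i ∈ range p, f i = 0) (hf : ∀ n, |f n| ≤ 1) (n : ℕ) :
    |∑ i ∈ range n, f i| ≤ p := by
  induction n using Nat.strong_induction_on with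
  | _ n ih =>
    rcases lt_or_ge n p with h | h
    · calc |∑ i ∈ range n, f i| ≤ ∑ i ∈ range n, |f i| := abs_sum_le_sum_abs _ _
        _ ≤ ∑ i ∈ range n, 1 := sum_le_sum fun i _ ↦ hf i
        _ ≤ p := by simpa using h.le
    · obtain ⟨k, rfl⟩ := Nat.exists_eq_add_of_le h
      rw [sum_range_add, hsum, zero_add]
      simp_rw [add_comm p, hper]
      exact ih k (by omega)

open Finset in
theorem sum_divisors_quadraticChar_nonneg {p : ℕ} [Fact p.Prime] (N : ℕ) :
    0 ≤ ∑ d ∈ N.divisors, (quadraticChar (ZMod p) (d : ZMod p) : ℝ) := by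
  have hsq : (complexQuadraticChar p) ^ 2 = 1 :=
    MulChar.isQuadratic_iff_sq_eq_one.mp ((quadraticChar_isQuadratic (ZMod p)).comp _)
  have h := DirichletCharacter.zetaMul_nonneg (N := p) hsq N
  rw [DirichletCharacter.zetaMul, ArithmeticFunction.coe_zeta_mul_apply] at h
  have h2 : ∑ i ∈ N.divisors, toArithmeticFunction (complexQuadraticChar p ·) i =
      ((∑ d ∈ N.divisors, (quadraticChar (ZMod p) (d : ZMod p) : ℝ) : ℝ) : ℂ) := by
    push_cast
    refine sum_congr rfl fun d hd ↦ ?_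
    have : d ≠ 0 := (Nat.pos_of_mem_divisors hd).ne'
    simp [toArithmeticFunction, this, complexQuadraticChar_apply]
  rw [h2] at h
  exact_mod_cast h

open Finset in
-- For N = p^k only the divisor 1 contributes, since χ(p) = 0.
theorem infinite_one_le_sum_divisors_quadraticChar {p : ℕ} [Fact p.Prime] :
    {N : ℕ+ | 1 ≤ ∑ d ∈ (N : ℕ).divisors,
      (quadraticChar (ZMod p) (d : ZMod p) : ℝ)}.Infinite := by
  have hp : p.Prime := Fact.out
  refine Set.infinite_of_injective_forall_mem
    (f := fun k : ℕ ↦ (⟨p ^ k, pow_pos hp.pos k⟩ : ℕ+)) ?_ ?_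
  · intro k l h
    exact Nat.pow_right_injective hp.two_le (congrArg PNat.val h)
  · intro k
    change 1 ≤ ∑ d ∈ (p ^ k).divisors, (quadraticChar (ZMod p) (d : ZMod p) : ℝ)
    rw [Nat.sum_divisors_prime_pow hp, sum_range_succ', sum_eq_zero]
    · simp
    · intro i _
      simp

theorem abs_quadraticChar_le_one {p : ℕ} [Fact p.Prime] (a : ZMod p) :
    |(quadraticChar (ZMod p) a : ℝ)| ≤ 1 := by
  rcases quadraticChar_isQuadratic (ZMod p) a with h | h | h <;> simp [h]

open Finset in
theorem abs_sum_range_quadraticChar_le {p : ℕ} [Fact p.Prime] (hp : p ≠ 2) (n : ℕ) :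
    |∑ i ∈ range n, (quadraticChar (ZMod p) ((i + 1 : ℕ) : ZMod p) : ℝ)| ≤ p := by
  have h := abs_sum_range_le_of_periodic (f := fun i ↦ (quadraticChar (ZMod p) (i : ZMod p) : ℝ))
    (Fact.out : p.Prime).pos (fun n ↦ by simp) ?_ (fun n ↦ abs_quadraticChar_le_one _) (n + 1)
  · rw [sum_range_succ'] at h
    simpa using h
  · rw [← ZMod.sum_eq_sum_range p (fun a ↦ (quadraticChar (ZMod p) a : ℝ))]
    exact_mod_cast quadraticChar_sum_zero (ringChar_zmod_ne_two hp)

open Finset Filter Topology in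
theorem exists_tendsto_sum_quadraticChar_div {p : ℕ} [Fact p.Prime] (hp : p ≠ 2) :
    ∃ L : ℝ, 0 < L ∧ Tendsto (fun n ↦ ∑ i ∈ range n,
      (quadraticChar (ZMod p) ((i + 1 : ℕ) : ZMod p) : ℝ) / ((i : ℝ) + 1)) atTop (𝓝 L) := by
  have hanti : Antitone fun n : ℕ ↦ 1 / ((n : ℝ) + 1) := fun a b h ↦ by
    dsimp only
    gcongr
  obtain ⟨L, hL⟩ := cauchySeq_tendsto_of_complete
    (hanti.cauchySeq_series_mul_of_tendsto_zero_of_bounded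
      tendsto_one_div_add_atTop_nhds_zero_nat
      (z := fun i ↦ (quadraticChar (ZMod p) ((i + 1 : ℕ) : ZMod p) : ℝ))
      (abs_sum_range_quadraticChar_le hp))
  have hL' : Tendsto (fun n ↦ ∑ i ∈ range n,
      (quadraticChar (ZMod p) ((i + 1 : ℕ) : ZMod p) : ℝ) / ((i : ℝ) + 1)) atTop (𝓝 L) := by
    refine hL.congr fun n ↦ sum_congr rfl fun i _ ↦ ?_
    rw [smul_eq_mul]; ring
  exact ⟨L, pos_of_tendsto_sum_div (f := fun n ↦ (quadraticChar (ZMod p) (n : ZMod p) : ℝ))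
    (fun n ↦ abs_quadraticChar_le_one _) (abs_sum_range_quadraticChar_le hp)
    sum_divisors_quadraticChar_nonneg infinite_one_le_sum_divisors_quadraticChar hL', hL'⟩

/-! ### Finite sums of the quadratic character -/

open Finset in
theorem sum_range_eq_sum_reflect {M : Type*} [AddCommMonoid M] (g : ℕ → M) (m : ℕ) :
    ∑ j ∈ range (2 * m + 1), g j =
      g 0 + ∑ k ∈ range m, (g (k + 1) + g (2 * m + 1 - (k + 1))) := by
  rw [sum_range_succ', add_comm, two_mul, sum_range_add, sum_add_distrib]
  congr 2
  rw [← sum_range_reflect]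
  refine sum_congr rfl fun k hk ↦ congrArg g ?_
  have : k < m := by simpa using hk
  omega

open Finset in
theorem sum_range_eq_sum_even_reflect {M : Type*} [AddCommMonoid M] (g : ℕ → M) (m : ℕ) :
    ∑ j ∈ range (2 * m + 1), g j =
      g 0 + ∑ k ∈ range m, (g (2 * (k + 1)) + g (2 * m + 1 - 2 * (k + 1))) := by
  have h : ∀ n, ∑ j ∈ range (2 * n + 1), g j =
      g 0 + ∑ k ∈ range n, (g (2 * (k + 1)) + g (2 * k + 1)) := by
    intro n
    induction n with
    | zero => simp
    | succ n ih =>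
      rw [show 2 * (n + 1) + 1 = 2 * n + 1 + 1 + 1 by ring, sum_range_succ, sum_range_succ, ih,
        sum_range_succ _ n, show 2 * (n + 1) = 2 * n + 1 + 1 by ring,
        add_comm (g (2 * n + 1 + 1)), add_assoc, add_assoc]
  rw [h, sum_add_distrib, sum_add_distrib]
  congr 2
  rw [← sum_range_reflect]
  refine sum_congr rfl fun k hk ↦ congrArg g ?_
  have : k < m := by simpa using hk
  omega

theorem quadraticChar_neg_of_mod_four {p : ℕ} [Fact p.Prime] (hp : p % 4 = 3) (a : ZMod p) :
    quadraticChar (ZMod p) (-a) = -quadraticChar (ZMod p) a := by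
  rw [← neg_one_mul, map_mul, quadraticChar_neg_one (ringChar_zmod_ne_two (by omega)), ZMod.card,
    ZMod.χ₄_nat_three_mod_four hp, neg_one_mul]

theorem quadraticChar_natCast_sub {p : ℕ} [Fact p.Prime] (hp : p % 4 = 3) {j : ℕ} (hj : j ≤ p) :
    quadraticChar (ZMod p) ((p - j : ℕ) : ZMod p) = -quadraticChar (ZMod p) (j : ZMod p) := by
  rw [← quadraticChar_neg_of_mod_four hp, Nat.cast_sub hj, ZMod.natCast_self, zero_sub]

open Finset in
theorem sum_quadraticChar_mul_natCast_neg {p : ℕ} [Fact p.Prime] (hp : p % 4 = 3) :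
    ∑ j ∈ range p, quadraticChar (ZMod p) (j : ZMod p) * (j : ℤ) < 0 := by
  have hp0 : (0 : ℝ) < p := Nat.cast_pos.mpr (Fact.out : p.Prime).pos
  obtain ⟨L, hL0, hL⟩ := exists_tendsto_sum_quadraticChar_div (p := p) (by omega)
  have h := sqrt_mul_eq_neg_pi_div_mul_sum hp hL
  have h1 : 0 < Real.sqrt p * L := mul_pos (Real.sqrt_pos.mpr hp0) hL0
  have h2 : 0 < Real.pi / p := div_pos Real.pi_pos hp0
  rw [h] at h1
  have h3 : ∑ j ∈ range p, (quadraticChar (ZMod p) (j : ZMod p) : ℝ) * j < 0 := by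
    by_contra! hc
    nlinarith [mul_nonneg h2.le hc]
  exact_mod_cast h3

open Finset in
-- Let H = ∑ χ(k) and B = ∑ k χ(k) over 1 ≤ k ≤ m. Pairing k with p - k gives A = 2B - pH, pairing
-- 2k with p - 2k gives A = χ(2)(4B - pH) and D = 2χ(2)H. Now eliminate B and H.
theorem alternating_sum_quadraticChar_mul {p : ℕ} [Fact p.Prime] (hp : p % 4 = 3) :
    p * ∑ j ∈ range p, (-1) ^ j * quadraticChar (ZMod p) (j : ZMod p) =
      -2 * quadraticChar (ZMod p) 2 * (2 - quadraticChar (ZMod p) 2) *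
        ∑ j ∈ range p, quadraticChar (ZMod p) (j : ZMod p) * (j : ℤ) := by
  obtain ⟨m, hpm⟩ : ∃ m, p = 2 * m + 1 := ⟨p / 2, by omega⟩
  set χ : ℕ → ℤ := fun j ↦ quadraticChar (ZMod p) (j : ZMod p) with hχ
  have hneg : ∀ j, j ≤ p → χ (p - j) = -χ j := fun j hj ↦ quadraticChar_natCast_sub hp hj
  have htwo : ∀ j, χ (2 * j) = χ 2 * χ j := fun j ↦ by
    simp only [hχ, Nat.cast_mul, map_mul]
  have hc2 : quadraticChar (ZMod p) 2 = χ 2 := by simp [hχ]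
  have h0 : χ 0 = 0 := by simp [hχ]
  rw [hc2]
  change (p : ℤ) * ∑ j ∈ range p, (-1) ^ j * χ j =
    -2 * χ 2 * (2 - χ 2) * ∑ j ∈ range p, χ j * (j : ℤ)
  have hlt : ∀ k ∈ range m, k < m := fun k hk ↦ by simpa using hk
  have hD : ∑ j ∈ range p, (-1) ^ j * χ j = 2 * χ 2 * ∑ k ∈ range m, χ (k + 1) := by
    have h := sum_range_eq_sum_even_reflect (fun j ↦ (-1) ^ j * χ j) m
    rw [← hpm] at h
    rw [h, h0, mul_zero, zero_add, mul_sum]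
    refine sum_congr rfl fun k hk ↦ ?_
    have hk := hlt k hk
    have hodd : Odd (p - 2 * (k + 1)) := Nat.odd_iff.mpr (by omega)
    rw [hneg _ (by omega), htwo, hodd.neg_one_pow, (even_two_mul _).neg_one_pow]
    ring
  have hA1 : ∑ j ∈ range p, χ j * (j : ℤ) =
      2 * ∑ k ∈ range m, χ (k + 1) * ((k : ℤ) + 1) - p * ∑ k ∈ range m, χ (k + 1) := by
    have h := sum_range_eq_sum_reflect (fun j ↦ χ j * (j : ℤ)) m
    rw [← hpm] at h
    rw [h, h0, zero_mul, zero_add, mul_sum, mul_sum, ← sum_sub_distrib]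
    refine sum_congr rfl fun k hk ↦ ?_
    have hk := hlt k hk
    rw [hneg _ (by omega), Nat.cast_sub (by omega)]
    push_cast
    ring
  have hA2 : ∑ j ∈ range p, χ j * (j : ℤ) =
      χ 2 * (4 * ∑ k ∈ range m, χ (k + 1) * ((k : ℤ) + 1) - p * ∑ k ∈ range m, χ (k + 1)) := by
    have h := sum_range_eq_sum_even_reflect (fun j ↦ χ j * (j : ℤ)) m
    rw [← hpm] at h
    rw [h, h0, zero_mul, zero_add, mul_sum, mul_sum, ← sum_sub_distrib, mul_sum]
    refine sum_congr rfl fun k hk ↦ ?_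
    have hk := hlt k hk
    rw [hneg _ (by omega), Nat.cast_sub (by omega), htwo]
    push_cast
    ring
  have h20 : (2 : ZMod p) ≠ 0 := by
    intro h
    have : ((2 : ℕ) : ZMod p) = 0 := by exact_mod_cast h
    rw [ZMod.natCast_eq_zero_iff] at this
    have := Nat.le_of_dvd two_pos this
    omega
  have hsq : χ 2 ^ 2 = 1 := by rw [← hc2]; exact quadraticChar_sq_one h20
  rw [hD]
  linear_combination (-2 * χ 2) * (χ 2 * hA2 - 2 * hA1) -
    2 * χ 2 * (2 * (2 * ∑ k ∈ range m, χ (k + 1) * ((k : ℤ) + 1)) -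
      p * ∑ k ∈ range m, χ (k + 1)) * hsq

open Finset in
theorem sum_neg_one_pow_mul_of_reflect {p m : ℕ} (hpm : p = 2 * m + 1) {g : ℕ → ℤ}
    (h0 : g 0 = 0) (hg : ∀ j, j ≤ p → g (p - j) = g j) :
    ∑ j ∈ range p, (-1) ^ j * g j = 0 := by
  have h := sum_range_eq_sum_reflect (fun j ↦ (-1) ^ j * g j) m
  rw [← hpm] at h
  rw [h, h0, mul_zero, zero_add]
  refine sum_eq_zero fun k hk ↦ ?_
  have hk : k < m := by simpa using hk
  rw [hg _ (by omega)]
  have h1 : (-1 : ℤ) ^ (k + 1) * (-1) ^ (p - (k + 1)) = -1 := by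
    rw [← pow_add, Nat.add_sub_cancel' (by omega), hpm, pow_succ, pow_mul]
    simp
  have h2 : (-1 : ℤ) ^ (k + 1) * (-1) ^ (k + 1) = 1 := by
    rw [← mul_pow]; simp
  linear_combination (g (k + 1) * (-1) ^ (k + 1)) * h1 -
    g (k + 1) * (-1) ^ (p - (k + 1)) * h2

/-! ### Counting odd and even residues -/

theorem isQuadraticResidue_iff {p : ℕ} [Fact p.Prime] (k : ℕ) :
    IsQuadraticResidue p k ↔ quadraticChar (ZMod p) (k : ZMod p) = 1 := by
  constructor
  · rintro ⟨h0, h1⟩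
    exact (quadraticChar_one_iff_isSquare h0).mpr h1
  · intro h
    have h0 : (k : ZMod p) ≠ 0 := fun h0 ↦ by simp [h0] at h
    exact ⟨h0, (quadraticChar_one_iff_isSquare h0).mp h⟩

open Finset in
theorem ncard_residues_eq_sum {p : ℕ} [Fact p.Prime] (P : ℕ → Prop) [DecidablePred P] :
    ({k | k ∈ Set.Icc 1 (p - 1) ∧ P k ∧ IsQuadraticResidue p k}.ncard : ℤ) =
      ∑ j ∈ range p, if P j ∧ quadraticChar (ZMod p) (j : ZMod p) = 1 then 1 else 0 := by
  have hp := (Fact.out : p.Prime).pos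
  have h : {k | k ∈ Set.Icc 1 (p - 1) ∧ P k ∧ IsQuadraticResidue p k} =
      (((range p).filter fun j ↦ P j ∧ quadraticChar (ZMod p) (j : ZMod p) = 1 : Finset ℕ) :
        Set ℕ) := by
    ext k
    simp only [isQuadraticResidue_iff, Set.mem_ofPred_eq, coe_filter, mem_range, Set.mem_Icc]
    constructor
    · rintro ⟨h1, h2⟩
      exact ⟨by omega, h2⟩
    · rintro ⟨h1, h2⟩
      refine ⟨⟨?_, by omega⟩, h2⟩
      by_contra hk
      obtain rfl : k = 0 := by omega
      simp at h2
  rw [h, Set.ncard_coe_finset, card_filter]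
  push_cast
  rfl

open Finset in
theorem two_mul_ncard_oddResidues_sub {p : ℕ} [Fact p.Prime] (hp : p % 4 = 3) :
    2 * (((oddResidues p).ncard : ℤ) - (evenResidues p).ncard) =
      -∑ j ∈ range p, (-1) ^ j * quadraticChar (ZMod p) (j : ZMod p) := by
  rw [oddResidues, evenResidues, ncard_residues_eq_sum, ncard_residues_eq_sum]
  have h0 := sum_neg_one_pow_mul_of_reflect (p := p) (m := p / 2) (by omega)
    (g := fun j ↦ quadraticChar (ZMod p) (j : ZMod p) ^ 2) (by simp)
    (fun j hj ↦ by rw [quadraticChar_natCast_sub hp hj, neg_sq])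
  -- Twice the indicator of χ = 1 is χ + χ². The χ² part vanishes in the alternating sum because j
  -- and p - j have opposite parity.
  suffices h : 2 * ((∑ j ∈ range p,
        if Odd j ∧ quadraticChar (ZMod p) (j : ZMod p) = 1 then (1 : ℤ) else 0) -
      ∑ j ∈ range p, if Even j ∧ quadraticChar (ZMod p) (j : ZMod p) = 1 then (1 : ℤ) else 0) =
      -∑ j ∈ range p, (-1) ^ j * quadraticChar (ZMod p) (j : ZMod p) -
        ∑ j ∈ range p, (-1) ^ j * quadraticChar (ZMod p) (j : ZMod p) ^ 2 by
    rw [h, h0, sub_zero]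
  clear h0
  rw [← sum_sub_distrib, mul_sum, ← sum_neg_distrib, ← sum_sub_distrib]
  refine sum_congr rfl fun j _ ↦ ?_
  rcases Nat.even_or_odd j with hj | hj
  · rw [hj.neg_one_pow, if_neg (fun h ↦ (Nat.not_odd_iff_even.mpr hj) h.1)]
    rcases quadraticChar_isQuadratic (ZMod p) (j : ZMod p) with h | h | h <;> simp [h, hj]
  · rw [hj.neg_one_pow, if_neg (c := Even j ∧ _) (fun h ↦ (Nat.not_even_iff_odd.mpr hj) h.1)]
    rcases quadraticChar_isQuadratic (ZMod p) (j : ZMod p) with h | h | h <;> simp [h, hj]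

/-! ### Tangent sums -/

open Finset in
-- With z = e(k/p) = exp(2iθ) the geometric sum is 2/(1 + z) = exp(-iθ)/cos θ.
theorem sum_neg_one_pow_mul_stdAddChar {p : ℕ} [Fact p.Prime] (hp : Odd p) (k : ℤ) :
    ∑ j ∈ range p, (-1) ^ j * ZMod.stdAddChar ((k : ZMod p) * (j : ZMod p)) =
      1 - Complex.I * (Real.tan (Real.pi * k / p) : ℝ) := by
  set z := ZMod.stdAddChar (k : ZMod p) with hz
  set θ : ℝ := Real.pi * k / p with hθ
  have hzp : z ^ p = 1 := by rw [hz, ← AddChar.map_nsmul_eq_pow]; simp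
  have h1 : 1 + z ≠ 0 := by
    intro h
    have h2 : z = -1 := by linear_combination h
    rw [h2, hp.neg_one_pow] at hzp
    norm_num at hzp
  have hzθ : z = Complex.exp (θ * Complex.I) ^ 2 := by
    rw [hz, ZMod.stdAddChar_coe, ← Complex.exp_nat_mul]
    congr 1
    rw [hθ]
    push_cast
    ring
  have hsum : (∑ j ∈ range p, (-1) ^ j * ZMod.stdAddChar ((k : ZMod p) * (j : ZMod p))) * (1 + z) =
      2 := by
    have h2 : ∀ j ∈ range p, (-1) ^ j * ZMod.stdAddChar ((k : ZMod p) * (j : ZMod p)) =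
        (-z) ^ j := by
      intro j _
      rw [neg_pow z, hz, ← AddChar.map_nsmul_eq_pow, nsmul_eq_mul, mul_comm (j : ZMod p)]
    have h3 := geom_sum_mul_neg (-z) p
    rw [hp.neg_pow, hzp] at h3
    rw [sum_congr rfl h2]
    linear_combination h3
  have hexp : Complex.exp (θ * Complex.I) = Real.cos θ + Real.sin θ * Complex.I := by
    rw [Complex.exp_mul_I, Complex.ofReal_cos, Complex.ofReal_sin]
  have hcs : (Real.sin θ : ℂ) ^ 2 + (Real.cos θ : ℂ) ^ 2 = 1 := by
    exact_mod_cast Real.sin_sq_add_cos_sq θ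
  have h1z : 1 + z = 2 * Real.cos θ * (Real.cos θ + Real.sin θ * Complex.I) := by
    rw [hzθ, hexp]
    linear_combination (Real.sin θ : ℂ) ^ 2 * Complex.I_sq - hcs
  have hcos : (Real.cos θ : ℂ) ≠ 0 := by
    intro h
    rw [h1z, h] at h1
    simp at h1
  apply mul_right_cancel₀ h1
  rw [hsum, h1z, Real.tan_eq_sin_div_cos, Complex.ofReal_div]
  field_simp
  linear_combination (Real.sin θ : ℂ) ^ 2 * Complex.I_sq - hcs

theorem tan_eq_of_intCast_eq {p : ℕ} [Fact p.Prime] (hp : Odd p) {k l : ℤ}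
    (h : (k : ZMod p) = l) : Real.tan (Real.pi * k / p) = Real.tan (Real.pi * l / p) := by
  have hk := sum_neg_one_pow_mul_stdAddChar hp k
  rw [h, sum_neg_one_pow_mul_stdAddChar hp l] at hk
  have h1 : ((Real.tan (Real.pi * k / p) : ℝ) : ℂ) = (Real.tan (Real.pi * l / p) : ℝ) := by
    apply mul_left_cancel₀ Complex.I_ne_zero
    linear_combination hk
  exact_mod_cast h1

/-- The function `a ↦ tan (π a / p)` on residue classes. -/
noncomputable def zmodTan (p : ℕ) (a : ZMod p) : ℝ := Real.tan (Real.pi * a.val / p)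

theorem zmodTan_intCast {p : ℕ} [Fact p.Prime] (hp : Odd p) (k : ℤ) :
    zmodTan p k = Real.tan (Real.pi * k / p) := by
  have := tan_eq_of_intCast_eq hp (k := ((k : ZMod p).val : ℤ)) (l := k) (by simp)
  rwa [Int.cast_natCast] at this

theorem zmodTan_neg {p : ℕ} [Fact p.Prime] (hp : Odd p) (a : ZMod p) :
    zmodTan p (-a) = -zmodTan p a := by
  have h := zmodTan_intCast hp (-(a.val : ℤ))
  have h2 := zmodTan_intCast hp (a.val : ℤ)
  push_cast at h h2
  rw [ZMod.natCast_zmod_val] at h h2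
  rw [h, h2, mul_neg, neg_div, Real.tan_neg]

theorem sum_zmodTan {p : ℕ} [Fact p.Prime] (hp : Odd p) : ∑ a : ZMod p, zmodTan p a = 0 := by
  have h := Equiv.sum_comp (Equiv.neg (ZMod p)) (zmodTan p)
  simp only [Equiv.neg_apply, zmodTan_neg hp, Finset.sum_neg_distrib] at h
  linarith

open Finset in
-- Insert the finite Fourier expansion of the tangent and exchange sums; each inner sum is χ(j) i√p.
theorem sum_quadraticChar_mul_zmodTan {p : ℕ} [Fact p.Prime] (hp : p % 4 = 3) :
    ∑ a : ZMod p, (quadraticChar (ZMod p) a : ℝ) * zmodTan p a =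
      -Real.sqrt p * ∑ j ∈ range p, (-1) ^ j * (quadraticChar (ZMod p) (j : ZMod p) : ℝ) := by
  have hodd : Odd p := Nat.odd_iff.mpr (by omega)
  have h1 : ∀ a : ZMod p, 1 - Complex.I * (zmodTan p a : ℝ) =
      ∑ j ∈ range p, (-1) ^ j * ZMod.stdAddChar ((j : ZMod p) * a) := by
    intro a
    have h := sum_neg_one_pow_mul_stdAddChar hodd (a.val : ℤ)
    rw [Int.cast_natCast, Int.cast_natCast, ZMod.natCast_zmod_val] at h
    rw [zmodTan, ← h]
    simp_rw [mul_comm]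
  have h2 : ∑ a : ZMod p, (quadraticChar (ZMod p) a : ℂ) * (1 - Complex.I * (zmodTan p a : ℝ)) =
      ∑ j ∈ range p, (-1) ^ j * ((quadraticChar (ZMod p) (j : ZMod p) : ℂ) *
        (Complex.I * (Real.sqrt p : ℝ))) := by
    simp_rw [h1, mul_sum]
    rw [sum_comm]
    refine sum_congr rfl fun j _ ↦ ?_
    rw [← gaussSum_complexQuadraticChar_stdAddChar hp,
      ← sum_quadraticChar_mul_mulShift (by omega), mul_sum]
    exact sum_congr rfl fun a _ ↦ by ring
  have h3 : ∑ a : ZMod p, (quadraticChar (ZMod p) a : ℂ) = 0 := by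
    exact_mod_cast quadraticChar_sum_zero (ringChar_zmod_ne_two (p := p) (by omega))
  have h4 : Complex.I * ∑ a : ZMod p, (quadraticChar (ZMod p) a : ℂ) * (zmodTan p a : ℝ) =
      Complex.I * (-(Real.sqrt p : ℝ) *
        ∑ j ∈ range p, (-1) ^ j * (quadraticChar (ZMod p) (j : ZMod p) : ℂ)) := by
    have h5 : ∑ a : ZMod p, (quadraticChar (ZMod p) a : ℂ) * (1 - Complex.I * (zmodTan p a : ℝ)) =
        ∑ a : ZMod p, (quadraticChar (ZMod p) a : ℂ) -
          Complex.I * ∑ a : ZMod p, (quadraticChar (ZMod p) a : ℂ) * (zmodTan p a : ℝ) := by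
      rw [mul_sum, ← sum_sub_distrib]
      exact sum_congr rfl fun a _ ↦ by ring
    have h6 : ∑ j ∈ range p, (-1) ^ j * ((quadraticChar (ZMod p) (j : ZMod p) : ℂ) *
        (Complex.I * (Real.sqrt p : ℝ))) = (Complex.I * (Real.sqrt p : ℝ)) *
        ∑ j ∈ range p, (-1) ^ j * (quadraticChar (ZMod p) (j : ZMod p) : ℂ) := by
      rw [mul_sum]
      exact sum_congr rfl fun a _ ↦ by ring
    rw [h5, h6, h3] at h2
    linear_combination -h2
  have h7 := mul_left_cancel₀ Complex.I_ne_zero h4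
  exact_mod_cast h7

open Finset in
-- Each a has χ(a) + 1 square roots.
theorem sum_comp_sq_eq {p : ℕ} [Fact p.Prime] (hp : p ≠ 2) (f : ZMod p → ℝ) :
    ∑ x : ZMod p, f (x ^ 2) = ∑ a : ZMod p, ((quadraticChar (ZMod p) a : ℝ) + 1) * f a := by
  rw [← sum_fiberwise univ (fun x : ZMod p ↦ x ^ 2)]
  refine sum_congr rfl fun a _ ↦ ?_
  have h := quadraticChar_card_sqrts (ringChar_zmod_ne_two hp) a
  have h2 : {x : ZMod p | x ^ 2 = a}.toFinset = univ.filter fun x : ZMod p ↦ x ^ 2 = a := by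
    ext; simp
  rw [h2] at h
  rw [sum_congr rfl (g := fun _ ↦ f a) (fun x hx ↦ by rw [(mem_filter.mp hx).2]), sum_const,
    nsmul_eq_mul]
  congr 1
  exact_mod_cast h

open Finset in
-- Since n and p - n have the same square, the half-range sum doubles to a sum over all squares.
-- There the unweighted tangents cancel by oddness, leaving the χ-weighted sum.
theorem two_mul_tanSum {p : ℕ} [Fact p.Prime] (hp : p % 4 = 3) : 2 * tanSum p =
    -p * ∑ j ∈ range p, (-1) ^ j * (quadraticChar (ZMod p) (j : ZMod p) : ℝ) := by
  have hodd : Odd p := Nat.odd_iff.mpr (by omega)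
  obtain ⟨m, hpm⟩ : ∃ m, p = 2 * m + 1 := ⟨p / 2, by omega⟩
  have h1 := sum_comp_sq_eq (p := p) (by omega) (zmodTan p)
  simp_rw [add_mul, one_mul] at h1
  rw [sum_add_distrib, sum_zmodTan hodd, add_zero, sum_quadraticChar_mul_zmodTan hp,
    ZMod.sum_eq_sum_range] at h1
  have h2 := sum_range_eq_sum_reflect (fun j ↦ zmodTan p ((j : ZMod p) ^ 2)) m
  rw [← hpm] at h2
  have h3 : ∀ k ∈ range m, zmodTan p (((k + 1 : ℕ) : ZMod p) ^ 2) +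
      zmodTan p (((p - (k + 1) : ℕ) : ZMod p) ^ 2) =
      2 * Real.tan (Real.pi * ((k + 1 : ℕ) : ℝ) ^ 2 / p) := by
    intro k hk
    have hk : k < m := by simpa using hk
    have h4 := zmodTan_intCast hodd (((k + 1 : ℕ) : ℤ) ^ 2)
    rw [Int.cast_pow, Int.cast_pow, Int.cast_natCast, Int.cast_natCast] at h4
    rw [Nat.cast_sub (by omega), ZMod.natCast_self, zero_sub, neg_sq, h4, two_mul]
  have h5 : zmodTan p (((0 : ℕ) : ZMod p) ^ 2) = 0 := by simp [zmodTan]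
  rw [h5, zero_add, sum_congr rfl h3, h1, ← mul_sum] at h2
  have h6 : ∑ n ∈ Icc 1 ((p - 1) / 2), Real.tan (Real.pi * (n : ℝ) ^ 2 / p) =
      ∑ k ∈ range m, Real.tan (Real.pi * ((k + 1 : ℕ) : ℝ) ^ 2 / p) := by
    rw [show (p - 1) / 2 = m by omega, range_eq_Ico, sum_Ico_add'
      (fun n : ℕ ↦ Real.tan (Real.pi * (n : ℝ) ^ 2 / p)) 0 m 1, zero_add]
    rfl
  have h7 : Real.sqrt p * Real.sqrt p = p := Real.mul_self_sqrt (Nat.cast_nonneg p)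
  rw [tanSum, h6]
  linear_combination (-Real.sqrt p) * h2 -
    (∑ j ∈ range p, (-1) ^ j * (quadraticChar (ZMod p) (j : ZMod p) : ℝ)) * h7

/-! ### Conclusion -/

theorem mainTheorem3 (p : ℕ) (hp : p.Prime) :
    (p ≡ 3 [MOD 8] → 0 < tanSum p ∧ (evenResidues p).ncard < (oddResidues p).ncard) ∧
    (p ≡ 7 [MOD 8] → tanSum p < 0 ∧ (oddResidues p).ncard < (evenResidues p).ncard) := by
  have : Fact p.Prime := ⟨hp⟩
  have hp0 : (0 : ℤ) < p := Nat.cast_pos.mpr hp.pos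
  have hp0' : (0 : ℝ) < p := Nat.cast_pos.mpr hp.pos
  have hcast : ((∑ j ∈ Finset.range p, (-1) ^ j * quadraticChar (ZMod p) (j : ZMod p) : ℤ) : ℝ) =
      ∑ j ∈ Finset.range p, (-1) ^ j * (quadraticChar (ZMod p) (j : ZMod p) : ℝ) := by
    push_cast; rfl
  constructor <;> intro hmod
  · have hp8 : p % 8 = 3 := hmod
    have hp4 : p % 4 = 3 := by omega
    have h2 : quadraticChar (ZMod p) 2 = -1 := by
      rw [quadraticChar_two (ringChar_zmod_ne_two (by omega)), ZMod.card,
        ZMod.χ₈_nat_eq_if_mod_eight]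
      simp [hp8]; omega
    have hA := sum_quadraticChar_mul_natCast_neg hp4
    have hD := alternating_sum_quadraticChar_mul hp4
    rw [h2] at hD
    -- Here χ(2) = -1, so pD = 6A < 0.
    have hneg : ∑ j ∈ Finset.range p, (-1) ^ j * quadraticChar (ZMod p) (j : ZMod p) < 0 :=
      neg_of_mul_neg_right (by rw [hD]; linarith) hp0.le
    have hT := two_mul_tanSum hp4
    have hN := two_mul_ncard_oddResidues_sub hp4
    rw [← hcast] at hT
    have hnegR := Int.cast_lt_zero (R := ℝ).mpr hneg
    refine ⟨?_, by omega⟩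
    linarith [mul_pos_of_neg_of_neg (neg_neg_of_pos hp0') hnegR]
  · have hp8 : p % 8 = 7 := hmod
    have hp4 : p % 4 = 3 := by omega
    have h2 : quadraticChar (ZMod p) 2 = 1 := by
      rw [quadraticChar_two (ringChar_zmod_ne_two (by omega)), ZMod.card,
        ZMod.χ₈_nat_eq_if_mod_eight]
      simp [hp8]; omega
    have hA := sum_quadraticChar_mul_natCast_neg hp4
    have hD := alternating_sum_quadraticChar_mul hp4
    rw [h2] at hD
    -- Here χ(2) = 1, so pD = -2A > 0.
    have hpos : 0 < ∑ j ∈ Finset.range p, (-1) ^ j * quadraticChar (ZMod p) (j : ZMod p) :=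
      pos_of_mul_pos_right (by rw [hD]; linarith) hp0.le
    have hT := two_mul_tanSum hp4
    have hN := two_mul_ncard_oddResidues_sub hp4
    rw [← hcast] at hT
    have hposR := Int.cast_pos (R := ℝ).mpr hpos
    refine ⟨?_, by omega⟩
    linarith [mul_pos hp0' hposR]
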